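/- For integers $n\ge 2$ and $k\ge 1$, let $T(n,k)$ be the $k$-level $n$-ary tree: $T(n,1)$ is the star $K_{1,n}$ with $n$ leaves, rooted at its center, and for $k\ge 2$ the tree $T(n,k)$ is obtained from $n$ disjoint copies of $T(n,k-1)$ by joining a new vertex, the root of $T(n,k)$, to the root of each copy. For a connected graph $G$, a proper vertex coloring $c$ with $m$ nonempty color classes $C_1,\dots,C_m$ is called a locating $m$-coloring if the color codes $(d(v,C_1),\dots,d(v,C_m))$, where $d(v,C_i)=\min_{x\in C_i} d(v,x)$, are distinct for distinct vertices $v$ of $G$. The locating-chromatic number $\chi_L(G)$ is the least positive integer $m$ such that $G$ has a locating $m$-coloring. Theorem. Fix an integer $k\ge 4$. Then there are only finitely many integers $n\ge 2$ with $\chi_L(T(n,k))<n+k-1$; moreover, $\chi_L(T(n,k))=n+k-1$ for all sufficiently large $n$. -/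

import Mathlib

namespace SimpleGraph

variable {V : Type*} {G : SimpleGraph V} {m : ℕ}

/-- The color code of the vertex `v` with respect to a (proper) coloring `c` with colors
`0, …, m - 1`: the `m`-tuple of the distances `d(v, C i) = min {d(v, x) | x ∈ C i}`, where
`C i` is the class of color `i`. -/
noncomputable def colorCode (c : G.Coloring (Fin m)) (v : V) (i : Fin m) : ℕ∞ :=
  ⨅ x ∈ c.colorClass i, G.edist v x

/-- A locating `m`-coloring: a proper coloring whose `m` color classes are all nonempty (so that
they partition the vertex set) and for which distinct vertices have distinct color codes. -/
def IsLocatingColoring (c : G.Coloring (Fin m)) : Prop :=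
  Function.Surjective c ∧ Function.Injective (colorCode c)

variable (G) in
/-- The locating-chromatic number: the least positive integer `m` such that `G` has a locating
`m`-coloring (and `⊤` if there is no such `m`, which is impossible for a finite nonempty graph). -/
noncomputable def locatingChromaticNumber : ℕ∞ :=
  ⨅ m ∈ {m : ℕ | 0 < m ∧ ∃ c : G.Coloring (Fin m), IsLocatingColoring c}, (m : ℕ∞)

end SimpleGraph

/-- The vertices of the `k`-level `n`-ary tree: a single vertex for `k = 0`; for `k + 1`, a new
vertex `none` and the vertices `some (i, x)`, where `x` is a vertex of the `i`-th of `n` disjoint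
copies of the `k`-level tree. -/
def NaryTreeVertex (n : ℕ) : ℕ → Type
  | 0 => Unit
  | k + 1 => Option (Fin n × NaryTreeVertex n k)

/-- The root (center) of the `k`-level `n`-ary tree. -/
def naryTreeRoot (n : ℕ) : (k : ℕ) → NaryTreeVertex n k
  | 0 => ()
  | _ + 1 => none

/-- Adjacency in the `k`-level `n`-ary tree: the new vertex is joined to the roots of the `n`
copies of the previous tree, and the edges inside each copy are kept. -/
def naryTreeAdj (n : ℕ) : (k : ℕ) → NaryTreeVertex n k → NaryTreeVertex n k → Prop
  | 0, _, _ => False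
  | _ + 1, none, none => False
  | k + 1, none, some (_, y) => y = naryTreeRoot n k
  | k + 1, some (_, x), none => x = naryTreeRoot n k
  | k + 1, some (i, x), some (j, y) => i = j ∧ naryTreeAdj n k x y

theorem naryTreeAdj_symm (n : ℕ) : ∀ (k : ℕ) (x y : NaryTreeVertex n k),
    naryTreeAdj n k x y → naryTreeAdj n k y x
  | 0, _, _, h => h
  | _ + 1, none, none, h => h
  | _ + 1, none, some _, h => h
  | _ + 1, some _, none, h => h
  | k + 1, some (_, x), some (_, y), h => ⟨h.1.symm, naryTreeAdj_symm n k x y h.2⟩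

theorem naryTreeAdj_irrefl (n : ℕ) : ∀ (k : ℕ) (x : NaryTreeVertex n k), ¬ naryTreeAdj n k x x
  | 0, _, h => h
  | _ + 1, none, h => h
  | k + 1, some (_, x), h => naryTreeAdj_irrefl n k x h.2

/-- The `k`-level `n`-ary tree `T(n, k)`. The recursion starts with a single vertex for `k = 0`,
so that `T(n, 1)` is the star `K_{1,n}` with `n` leaves, and `T(n, k + 1)` arises by joining a new
vertex to the roots of `n` disjoint copies of `T(n, k)`. -/
def naryTree (n k : ℕ) : SimpleGraph (NaryTreeVertex n k) where
  Adj := naryTreeAdj n k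
  symm := ⟨naryTreeAdj_symm n k⟩
  loopless := ⟨naryTreeAdj_irrefl n k⟩

/-! ### Distances to color classes in an arbitrary graph -/

namespace SimpleGraph

variable {V : Type*} {G : SimpleGraph V} {m : ℕ}

/-! Both bounds concern `n` large compared with `k`. Lower bound: the `n` leaves at a common
neighbor need distinct colors, so with at most `n + k - 2` colors the code of each of the `n ^ (k -
1)` star centers is `1` outside at most `k - 2` colors. Distances are at most `2 * k`, so there are
only `O(n ^ (k - 2))` possible codes, too few for large `n` (`exists_code_enumeration`,
`pow_le_of_isLocatingColoring`). Upper bound: `treeColor` is built by recursion on the height. Each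
level adds one color, and the branches at the new root omit pairwise distinct colors. The color
omitted by a branch is farther from its vertices than depth alone would allow elsewhere, so codes
reveal the branch, and recursion finishes (`treeColorDist_le`, `eq_of_treeColorDist_eq`). The
distances are certified by an explicit formula through `colorCode_eq_of_descent`. -/

theorem colorCode_le_edist (c : G.Coloring (Fin m)) (v x : V) :
    colorCode c v (c x) ≤ G.edist v x :=
  iInf₂_le (f := fun y (_ : y ∈ c.colorClass (c x)) => G.edist v y) x rfl

/-- A function that vanishes exactly on the color class, is `1`-Lipschitz along edges and can be
decreased along an edge from any point outside the class computes the distance to the class. -/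
theorem colorCode_eq_of_descent (c : G.Coloring (Fin m)) (i : Fin m) (D : V → ℕ)
    (hzero : ∀ v, D v = 0 ↔ c v = i) (hlip : ∀ u v, G.Adj u v → D u ≤ D v + 1)
    (hdesc : ∀ v, D v ≠ 0 → ∃ u, G.Adj v u ∧ D v = D u + 1) (v : V) :
    colorCode c v i = D v := by
  apply le_antisymm
  · have key : ∀ d : ℕ, ∀ v, D v = d → ∃ x, c x = i ∧ G.edist v x ≤ d := by
      intro d
      induction d with
      | zero => intro v hv; exact ⟨v, (hzero v).1 hv, by simp⟩
      | succ d ih =>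
        intro v hv
        obtain ⟨u, hu, hd⟩ := hdesc v (by omega)
        obtain ⟨x, hx, hux⟩ := ih u (by omega)
        refine ⟨x, hx, (G.edist_triangle (v := u)).trans ?_⟩
        rw [edist_eq_one_iff_adj.2 hu, add_comm]
        push_cast
        gcongr
    obtain ⟨x, hx, hvx⟩ := key _ v rfl
    subst hx
    exact (colorCode_le_edist c v x).trans hvx
  · refine le_iInf₂ fun x hx => le_iInf fun w => ?_
    have hw : ∀ {u y : V} (w : G.Walk u y), D u ≤ D y + w.length := by
      intro u y w
      induction w with
      | nil => simp
      | cons h w ih =>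
        have := hlip _ _ h
        rw [Walk.length_cons]
        omega
    have := hw w
    rw [(hzero x).2 hx, zero_add] at this
    exact_mod_cast this

theorem colorCode_eq_zero_iff (c : G.Coloring (Fin m)) (v : V) (i : Fin m) :
    colorCode c v i = 0 ↔ c v = i := by
  constructor
  · intro h
    by_contra hne
    have : (1 : ℕ∞) ≤ colorCode c v i := by
      refine le_iInf₂ fun x hx => ?_
      rw [Order.one_le_iff_ne_zero, Ne, edist_eq_zero_iff]
      rintro rfl
      exact hne hx
    rw [h] at this
    simp at this
  · rintro rfl
    have := colorCode_le_edist c v v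
    rw [edist_self] at this
    exact le_antisymm this (zero_le)

theorem colorCode_eq_one_of_adj (c : G.Coloring (Fin m)) {v u : V} (h : G.Adj v u) :
    colorCode c v (c u) = 1 := by
  apply le_antisymm
  · exact (colorCode_le_edist c v u).trans (edist_eq_one_iff_adj.2 h).le
  · rw [Order.one_le_iff_ne_zero, Ne, colorCode_eq_zero_iff]
    exact c.valid h

/-- A walk that leaves `v` must pass through `w`, and its first edge can be replaced by the edge
from `u`. -/
theorem colorCode_le_of_twins (c : G.Coloring (Fin m)) {u v w : V} (hu : G.Adj u w)
    (hv : ∀ x, G.Adj v x → x = w) (huv : c u = c v) (i : Fin m) :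
    colorCode c u i ≤ colorCode c v i := by
  by_cases hi : c u = i
  · rw [(colorCode_eq_zero_iff c u i).2 hi]
    exact zero_le
  · refine le_iInf₂ fun x hx => le_iInf fun p => ?_
    have hx' : c x = i := hx
    subst hx'
    cases p with
    | nil => exact absurd huv hi
    | @cons _ y _ h p =>
      obtain rfl := hv y h
      exact (colorCode_le_edist c u x).trans ((Walk.cons hu p).edist_le.trans (by simp))

/-- Two pendant vertices with the same neighbor have different colors in a locating coloring. -/
theorem IsLocatingColoring.eq_of_twins {c : G.Coloring (Fin m)} (hc : IsLocatingColoring c)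
    {u v w : V} (hu : G.Adj u w) (hv : G.Adj v w) (hu' : ∀ x, G.Adj u x → x = w)
    (hv' : ∀ x, G.Adj v x → x = w) (huv : c u = c v) : u = v :=
  hc.2 (funext fun i => le_antisymm (colorCode_le_of_twins c hu hv' huv i)
    (colorCode_le_of_twins c hv hu' huv.symm i))

end SimpleGraph

/-! ### Lower bound: counting the codes of star centers -/

section LowerBound

variable {n : ℕ}

theorem naryTree_adj_none_some {k : ℕ} (i : Fin n) :
    (naryTree n (k + 1)).Adj none (some (i, naryTreeRoot n k)) := rfl

theorem naryTree_edist_some_le {k : ℕ} (i : Fin n) (x y : NaryTreeVertex n k) :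
    (naryTree n (k + 1)).edist (some (i, x)) (some (i, y)) ≤ (naryTree n k).edist x y := by
  refine le_iInf fun p => ?_
  let f : naryTree n k →g naryTree n (k + 1) := ⟨fun x => some (i, x), fun h => ⟨rfl, h⟩⟩
  exact (p.map f).edist_le.trans (by simp)

theorem naryTree_edist_root_le : ∀ (k : ℕ) (x : NaryTreeVertex n k),
    (naryTree n k).edist x (naryTreeRoot n k) ≤ k
  | 0, x => by
    have : x = naryTreeRoot n 0 := rfl
    subst this
    simp
  | k + 1, none => by
    have : (naryTree n (k + 1)).edist (naryTreeRoot n (k + 1)) (naryTreeRoot n (k + 1)) ≤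
        ((k + 1 : ℕ) : ℕ∞) := by
      rw [SimpleGraph.edist_self]
      exact zero_le
    exact this
  | k + 1, some (i, x) => by
    have h1 := (naryTree_edist_some_le i x (naryTreeRoot n k)).trans (naryTree_edist_root_le k x)
    have h2 : (naryTree n (k + 1)).edist (some (i, naryTreeRoot n k)) none = 1 :=
      SimpleGraph.edist_eq_one_iff_adj.2 (naryTree_adj_none_some i).symm
    have h3 := SimpleGraph.edist_triangle.trans (add_le_add h1 h2.le)
    exact h3.trans (by push_cast; rfl)

theorem naryTree_edist_le (k : ℕ) (x y : NaryTreeVertex n k) :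
    (naryTree n k).edist x y ≤ (2 * k : ℕ) := by
  refine (SimpleGraph.edist_triangle (v := naryTreeRoot n k)).trans ?_
  rw [SimpleGraph.edist_comm (u := naryTreeRoot n k), two_mul]
  push_cast
  exact add_le_add (naryTree_edist_root_le k x) (naryTree_edist_root_le k y)

/-- The neighbors of the leaves, addressed by the path from the root. -/
def starCenter (n : ℕ) : (j : ℕ) → (Fin j → Fin n) → NaryTreeVertex n (j + 1)
  | 0, _ => none
  | j + 1, p => some (p 0, starCenter n j (Fin.tail p))

/-- The leaves adjacent to a given star center. -/
def starLeaf (n : ℕ) : (j : ℕ) → (Fin j → Fin n) → Fin n → NaryTreeVertex n (j + 1)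
  | 0, _, a => some (a, ())
  | j + 1, p, a => some (p 0, starLeaf n j (Fin.tail p) a)

theorem starCenter_injective : ∀ j : ℕ, Function.Injective (starCenter n j)
  | 0, p, q, _ => Subsingleton.elim p q
  | j + 1, p, q, h => by
    have h' : (p 0, starCenter n j (Fin.tail p)) = (q 0, starCenter n j (Fin.tail q)) :=
      Option.some.inj h
    have h1 := congrArg Prod.fst h'
    have h2 := starCenter_injective j (congrArg Prod.snd h')
    rw [← Fin.cons_self_tail p, ← Fin.cons_self_tail q, h2]
    exact congrArg (fun a => Fin.cons a (Fin.tail q)) h1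

theorem starLeaf_injective : ∀ (j : ℕ) (p : Fin j → Fin n), Function.Injective (starLeaf n j p)
  | 0, _, _, _, h => congrArg Prod.fst (Option.some.inj h)
  | j + 1, p, _, _, h =>
    starLeaf_injective j (Fin.tail p) (congrArg Prod.snd (Option.some.inj h))

theorem starLeaf_adj : ∀ (j : ℕ) (p : Fin j → Fin n) (a : Fin n),
    (naryTree n (j + 1)).Adj (starLeaf n j p a) (starCenter n j p)
  | 0, _, _ => rfl
  | j + 1, p, a => ⟨rfl, starLeaf_adj j (Fin.tail p) a⟩

theorem starLeaf_ne_root (j : ℕ) (p : Fin j → Fin n) (a : Fin n) :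
    starLeaf n j p a ≠ naryTreeRoot n (j + 1) := by
  cases j <;> exact Option.some_ne_none _

theorem eq_starCenter_of_adj : ∀ (j : ℕ) (p : Fin j → Fin n) (a : Fin n)
    (x : NaryTreeVertex n (j + 1)), (naryTree n (j + 1)).Adj (starLeaf n j p a) x →
      x = starCenter n j p
  | 0, _, _, none, _ => rfl
  | 0, _, _, some _, h => h.2.elim
  | j + 1, _, a, none, h => (starLeaf_ne_root j _ a h).elim
  | j + 1, p, a, some (_, x), h =>
    congrArg some (Prod.ext h.1.symm (eq_starCenter_of_adj j (Fin.tail p) a x h.2))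

open SimpleGraph

/-- The leaves at the center use `n` distinct colors, all at distance `1`; at most `j - 1` colors
remain. `F` lists these with their distances, which the diameter bound `2 * (j + 1)` limits, and so
determines the whole code. -/
theorem exists_code_enumeration {j m : ℕ} (hm : m + 1 ≤ n + j)
    {c : (naryTree n (j + 1)).Coloring (Fin m)} (hc : IsLocatingColoring c)
    (p : Fin j → Fin n) :
    ∃ F : Fin (j - 1) → Fin m × Fin (2 * (j + 1) + 1),
      (∀ t, colorCode c (starCenter n j p) (F t).1 = ((F t).2 : ℕ)) ∧
        ∀ i, (∀ t, (F t).1 ≠ i) → colorCode c (starCenter n j p) i = 1 := by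
  classical
  set v := starCenter n j p
  let L : Finset (Fin m) := Finset.univ.image fun a => c (starLeaf n j p a)
  have hL : L.card = n := by
    rw [Finset.card_image_of_injective, Finset.card_univ, Fintype.card_fin]
    intro a b hab
    exact starLeaf_injective j p (hc.eq_of_twins (starLeaf_adj j p a) (starLeaf_adj j p b)
      (eq_starCenter_of_adj j p a) (eq_starCenter_of_adj j p b) hab)
  have hcard : Fintype.card (Lᶜ : Finset (Fin m)) ≤ Fintype.card (Fin (j - 1)) := by
    rw [Fintype.card_coe, Finset.card_compl, hL, Fintype.card_fin, Fintype.card_fin]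
    omega
  have hv : c v ∈ Lᶜ := by
    simp only [L, Finset.mem_compl, Finset.mem_image, Finset.mem_univ, true_and, not_exists]
    exact fun a h => c.valid (starLeaf_adj j p a) h
  obtain ⟨e⟩ := Function.Embedding.nonempty_of_card_le hcard
  have : Nonempty (Lᶜ : Finset (Fin m)) := ⟨⟨_, hv⟩⟩
  have hfin : ∀ i, ∃ d : Fin (2 * (j + 1) + 1), colorCode c v i = (d : ℕ) := by
    intro i
    obtain ⟨x, rfl⟩ := hc.1 i
    have h := (colorCode_le_edist c v x).trans (naryTree_edist_le (j + 1) v x)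
    obtain ⟨d, hd⟩ := ENat.ne_top_iff_exists.1 (ne_top_of_le_ne_top (ENat.natCast_ne_top _) h)
    rw [← hd] at h ⊢
    exact ⟨⟨d, Nat.lt_succ_of_le (by exact_mod_cast h)⟩, rfl⟩
  choose d hd using hfin
  -- Indices outside the range of `e` take an arbitrary value in `Lᶜ`, which only repeats a
  -- remaining color. The center's own color shows that `Lᶜ` is nonempty.
  let f : Fin (j - 1) → (Lᶜ : Finset (Fin m)) := Function.invFun e
  refine ⟨fun t => (f t, d (f t)), fun t => hd _, fun i h => ?_⟩
  by_cases hi : i ∈ L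
  · obtain ⟨a, -, rfl⟩ := Finset.mem_image.1 hi
    exact colorCode_eq_one_of_adj c (starLeaf_adj j p a).symm
  · have : f (e ⟨i, Finset.mem_compl.2 hi⟩) = ⟨i, Finset.mem_compl.2 hi⟩ :=
      Function.leftInverse_invFun e.injective _
    exact (h _ (congrArg Subtype.val this)).elim

theorem pow_le_of_isLocatingColoring {j m : ℕ} (hm : m + 1 ≤ n + j)
    {c : (naryTree n (j + 1)).Coloring (Fin m)} (hc : IsLocatingColoring c) :
    n ^ j ≤ (m * (2 * (j + 1) + 1)) ^ (j - 1) := by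
  choose F hF using exists_code_enumeration hm hc
  have hinj : Function.Injective F := by
    intro p q hpq
    apply starCenter_injective j
    apply hc.2
    funext i
    obtain ⟨hp, hp'⟩ := hF p
    obtain ⟨hq, hq'⟩ := hF q
    rw [← hpq] at hq hq'
    by_cases h : ∃ t, (F p t).1 = i
    · obtain ⟨t, rfl⟩ := h
      rw [hp, hq]
    · push Not at h
      rw [hp' i h, hq' i h]
  have := Fintype.card_le_of_injective F hinj
  simpa using this

/-- For large `n`, a locating coloring of `T(n, j + 1)` has at least `n + j` colors. -/
theorem le_of_isLocatingColoring {j m : ℕ} (hj : 2 ≤ j) (hn : j ≤ n)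
    (hn' : (2 * (2 * (j + 1) + 1)) ^ (j - 1) < n)
    {c : (naryTree n (j + 1)).Coloring (Fin m)} (hc : IsLocatingColoring c) : n + j ≤ m := by
  by_contra! hlt
  have h1 := pow_le_of_isLocatingColoring (by omega) hc
  obtain ⟨q, rfl⟩ : ∃ q, j = q + 1 := ⟨j - 1, by omega⟩
  simp only [Nat.add_sub_cancel] at h1 hn'
  -- From `m ≤ 2 * n` the count is at most `n ^ q` times a constant depending only on `q`, and `hn'`
  -- makes that constant less than `n`.
  have h2 : (m * (2 * (q + 1 + 1) + 1)) ^ q ≤ (n * (2 * (2 * (q + 1 + 1) + 1))) ^ q := by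
    apply Nat.pow_le_pow_left
    have : m ≤ n * 2 := by omega
    calc _ ≤ n * 2 * (2 * (q + 1 + 1) + 1) := Nat.mul_le_mul_right _ this
      _ = _ := by ring
  rw [mul_pow n] at h2
  have h3 : n ^ q * (2 * (2 * (q + 1 + 1) + 1)) ^ q < n ^ q * n :=
    Nat.mul_lt_mul_of_pos_left hn' (Nat.pow_pos (by omega))
  exact absurd (h3.trans_le ((pow_succ n q).symm.le.trans h1)) (not_lt.2 h2)

end LowerBound

/-! ### Upper bound: an explicit locating coloring -/

section UpperBound

variable {N : ℕ}

/-- The color that is missing from the `i`-th branch of `T(N + 1, l + 3)`. -/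
def missingColor (N l : ℕ) (i : Fin (N + 1)) : Fin (N + (l + 1) + 2) := ⟨i + 2, by omega⟩

/-- A coloring of `T(N + 1, l + 2)` with `N + l + 2` colors. The vertices of height at least two
are colored alternately with `0` and `1`, and the branches of `T(N + 1, l + 3)` miss distinct
colors other than `0` and `1`. -/
def treeColor (N : ℕ) : (l : ℕ) → NaryTreeVertex (N + 1) (l + 2) → Fin (N + l + 2)
  | 0, none => 0
  | 0, some (a, none) => a.succ
  | 0, some (a, some (b, _)) => a.succ.succAbove b
  | l + 1, none => ⟨(l + 1) % 2, by omega⟩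
  | l + 1, some (i, x) => (missingColor N l i).succAbove (treeColor N l x)

/-- The depth of a vertex of the tree. -/
def treeDepth (n : ℕ) : (k : ℕ) → NaryTreeVertex n k → ℕ
  | 0, _ => 0
  | _ + 1, none => 0
  | k + 1, some (_, x) => treeDepth n k x + 1

/-- The distance from a vertex to the class of a color other than `0` and `1` in `treeColor`. -/
noncomputable def treeColorDist (N : ℕ) : (l : ℕ) → Fin (N + l + 2) → NaryTreeVertex (N + 1) (l + 2) → ℕ
  | 0, _, none => 1
  | 0, x, some (a, none) => if a.succ = x then 0 else 1
  | 0, x, some (a, some (b, _)) =>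
    if a.succ.succAbove b = x then 0 else if a.succ = x then 1 else 2
  | l + 1, _, none => l + 2
  | l + 1, x, some (i, y) =>
    -- A color absent from the branch is reached by climbing `treeDepth y + 1` edges to the new
    -- root, which is at distance `l + 2` from it. Any other color has its nearest vertex inside the
    -- branch.
    if h : x = missingColor N l i then l + 3 + treeDepth (N + 1) (l + 2) y
    else treeColorDist N l
      ((Fin.exists_succAbove_eq h).choose) y

theorem treeColorDist_missingColor (l : ℕ) (i : Fin (N + 1)) (y : NaryTreeVertex (N + 1) (l + 2)) :
    treeColorDist N (l + 1) (missingColor N l i) (some (i, y)) =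
      l + 3 + treeDepth (N + 1) (l + 2) y :=
  dif_pos rfl

theorem treeColorDist_succAbove (l : ℕ) (i : Fin (N + 1)) (y : NaryTreeVertex (N + 1) (l + 2))
    (x : Fin (N + l + 2)) :
    treeColorDist N (l + 1) ((missingColor N l i).succAbove x) (some (i, y)) =
      treeColorDist N l x y := by
  have h := (missingColor N l i).succAbove_ne x
  refine (dif_neg h).trans ?_
  congr 1
  exact Fin.succAbove_right_injective (Fin.exists_succAbove_eq h).choose_spec

theorem two_le_succAbove_iff (l : ℕ) (i : Fin (N + 1)) (x : Fin (N + l + 2)) :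
    2 ≤ ((missingColor N l i).succAbove x).val ↔ 2 ≤ x.val := by
  simp only [Fin.succAbove, missingColor, Fin.lt_def]
  split_ifs with h <;> simp at h ⊢; omega

/-- Missing colors are at least `2`, so relabeling a branch fixes `0` and `1` and the roots keep
alternating. -/
theorem succAbove_val_of_lt_two (l : ℕ) (i : Fin (N + 1)) (x : Fin (N + l + 2))
    (hx : x.val < 2) : ((missingColor N l i).succAbove x).val = x.val := by
  simp only [Fin.succAbove, missingColor, Fin.lt_def]
  split_ifs with h <;> simp at h ⊢; omega

theorem missingColor_injective (N l : ℕ) : Function.Injective (missingColor N l) := by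
  intro i j h
  simpa [missingColor, Fin.ext_iff] using h

theorem exists_ne_missingColor (hN : 1 ≤ N) (l : ℕ) (x : Fin (N + (l + 1) + 2)) :
    ∃ i, x ≠ missingColor N l i := by
  have : Nontrivial (Fin (N + 1)) := Fin.nontrivial_iff_two_le.2 (by omega)
  obtain ⟨i, hi⟩ := (missingColor_injective N l).exists_ne x
  exact ⟨i, hi.symm⟩

theorem treeColor_root_val (l : ℕ) :
    (treeColor N l (naryTreeRoot (N + 1) (l + 2))).val = l % 2 := by
  cases l <;> rfl

theorem treeColor_valid : ∀ (l : ℕ) (u v : NaryTreeVertex (N + 1) (l + 2)),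
    (naryTree (N + 1) (l + 2)).Adj u v → treeColor N l u ≠ treeColor N l v
  | 0, none, none, h => h.elim
  | 0, none, some (a, y), h => by
    obtain rfl : y = none := h
    exact (Fin.succ_ne_zero a).symm
  | 0, some (a, y), none, h => by
    obtain rfl : y = none := h
    exact Fin.succ_ne_zero a
  | 0, some (a, none), some (b, none), h => h.2.elim
  | 0, some (a, none), some (b, some (y, _)), h => by
    obtain rfl : a = b := h.1
    exact (Fin.succAbove_ne _ _).symm
  | 0, some (a, some (y, _)), some (b, none), h => by
    obtain rfl : a = b := h.1
    exact Fin.succAbove_ne _ _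
  | 0, some (_, some (_, _)), some (_, some (_, _)), h => h.2.2.elim
  | l + 1, none, none, h => h.elim
  | l + 1, none, some (a, y), h => by
    obtain rfl : y = naryTreeRoot (N + 1) (l + 2) := h
    intro h
    have h1 := congrArg Fin.val h
    have h2 : (l + 1) % 2 = ((missingColor N l a).succAbove
        (treeColor N l (naryTreeRoot (N + 1) (l + 2)))).val := h1
    rw [succAbove_val_of_lt_two _ _ _ (by rw [treeColor_root_val]; omega), treeColor_root_val] at h2
    omega
  | l + 1, some (a, y), none, h => by
    obtain rfl : y = naryTreeRoot (N + 1) (l + 2) := h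
    intro h
    have h1 := congrArg Fin.val h
    have h2 : ((missingColor N l a).succAbove
        (treeColor N l (naryTreeRoot (N + 1) (l + 2)))).val = (l + 1) % 2 := h1
    rw [succAbove_val_of_lt_two _ _ _ (by rw [treeColor_root_val]; omega), treeColor_root_val] at h2
    omega
  | l + 1, some (a, y), some (b, z), h => by
    obtain rfl : a = b := h.1
    exact fun h' => treeColor_valid l y z h.2 (Fin.succAbove_right_injective h')

theorem treeColor_surjective (hN : 1 ≤ N) : ∀ l, Function.Surjective (treeColor N l)
  | 0, x => by
    by_cases hx : x = 0
    · exact ⟨none, hx.symm⟩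
    · obtain ⟨a, rfl⟩ := Fin.exists_succ_eq.2 hx
      exact ⟨some (a, none), rfl⟩
  | l + 1, x => by
    obtain ⟨i, hi⟩ := exists_ne_missingColor hN l x
    obtain ⟨x', rfl⟩ := Fin.exists_succAbove_eq hi
    obtain ⟨y, rfl⟩ := treeColor_surjective hN l x'
    exact ⟨some (i, y), rfl⟩

theorem treeDepth_le_of_adj {n : ℕ} : ∀ (k : ℕ) (u v : NaryTreeVertex n k),
    (naryTree n k).Adj u v → treeDepth n k u ≤ treeDepth n k v + 1
  | 0, _, _, h => h.elim
  | _ + 1, none, _, _ => Nat.zero_le _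
  | k + 1, some (a, y), none, h => by
    obtain rfl : y = naryTreeRoot n k := h
    have : treeDepth n k (naryTreeRoot n k) = 0 := by cases k <;> rfl
    exact (congrArg (· + 1) this).le
  | k + 1, some (_, y), some (_, z), h => Nat.succ_le_succ (treeDepth_le_of_adj k y z h.2)

theorem treeDepth_root (n k : ℕ) : treeDepth n k (naryTreeRoot n k) = 0 := by
  cases k <;> rfl

theorem exists_adj_treeDepth {n : ℕ} : ∀ (k : ℕ) (v : NaryTreeVertex n k), v ≠ naryTreeRoot n k →
    ∃ u, (naryTree n k).Adj v u ∧ treeDepth n k v = treeDepth n k u + 1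
  | 0, _, h => (h rfl).elim
  | _ + 1, none, h => (h rfl).elim
  | k + 1, some (a, y), _ => by
    by_cases hy : y = naryTreeRoot n k
    · subst hy
      exact ⟨none, rfl, congrArg (· + 1) (treeDepth_root n k)⟩
    · obtain ⟨u, hu, h⟩ := exists_adj_treeDepth k y hy
      exact ⟨some (a, u), ⟨rfl, hu⟩, congrArg (· + 1) h⟩

theorem treeColorDist_root (l : ℕ) (x : Fin (N + l + 2)) :
    treeColorDist N l x (naryTreeRoot (N + 1) (l + 2)) = l + 1 := by
  cases l <;> rfl

theorem treeColorDist_eq_zero_iff : ∀ (l : ℕ) (x : Fin (N + l + 2)), 2 ≤ x.val →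
    ∀ v, treeColorDist N l x v = 0 ↔ treeColor N l v = x
  | 0, x, hx, none => by
    constructor
    · exact fun h => (one_ne_zero h).elim
    · rintro rfl
      simp [treeColor] at hx
  | 0, x, hx, some (a, none) => by
    simp [treeColor, treeColorDist]
  | 0, x, hx, some (a, some (b, _)) => by
    simp only [treeColor, treeColorDist]
    split_ifs <;> simp_all
  | l + 1, x, hx, none => by
    constructor
    · exact fun h => (Nat.succ_ne_zero _ h).elim
    · rintro rfl
      simp [treeColor] at hx
      omega
  | l + 1, x, hx, some (i, y) => by
    by_cases h : x = missingColor N l i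
    · subst h
      rw [treeColorDist_missingColor]
      have : treeColor N (l + 1) (some (i, y)) ≠ missingColor N l i := Fin.succAbove_ne _ _
      simp only [this, iff_false]
      omega
    · obtain ⟨x', rfl⟩ := Fin.exists_succAbove_eq h
      rw [two_le_succAbove_iff] at hx
      rw [treeColorDist_succAbove, treeColorDist_eq_zero_iff l x' hx y]
      exact Fin.succAbove_right_injective.eq_iff.symm

theorem treeColorDist_le_of_adj : ∀ (l : ℕ) (x : Fin (N + l + 2)) (u v),
    (naryTree (N + 1) (l + 2)).Adj u v → treeColorDist N l x u ≤ treeColorDist N l x v + 1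
  | 0, _, none, v, _ => Nat.le_add_left _ _
  | 0, x, some (a, none), v, _ => by
    simp only [treeColorDist]
    split_ifs <;> omega
  | 0, x, some (a, some (b, _)), none, h => by cases h
  | 0, x, some (a, some (b, _)), some (a', none), h => by
    obtain rfl : a = a' := h.1
    simp only [treeColorDist]
    split_ifs <;> omega
  | 0, x, some (a, some (b, _)), some (a', some _), h => h.2.2.elim
  | l + 1, x, none, none, h => h.elim
  | l + 1, x, none, some (i, y), h => by
    obtain rfl : y = naryTreeRoot (N + 1) (l + 2) := h
    by_cases h : x = missingColor N l i
    · subst h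
      rw [treeColorDist_missingColor, treeDepth_root]
      simp only [treeColorDist]
      omega
    · obtain ⟨x', rfl⟩ := Fin.exists_succAbove_eq h
      rw [treeColorDist_succAbove, treeColorDist_root]
      simp only [treeColorDist]
      omega
  | l + 1, x, some (i, y), none, h => by
    obtain rfl : y = naryTreeRoot (N + 1) (l + 2) := h
    by_cases h : x = missingColor N l i
    · subst h
      rw [treeColorDist_missingColor, treeDepth_root]
      simp only [treeColorDist]
      omega
    · obtain ⟨x', rfl⟩ := Fin.exists_succAbove_eq h
      rw [treeColorDist_succAbove, treeColorDist_root]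
      simp only [treeColorDist]
      omega
  | l + 1, x, some (i, y), some (j, z), h => by
    obtain rfl : i = j := h.1
    by_cases h' : x = missingColor N l i
    · subst h'
      rw [treeColorDist_missingColor, treeColorDist_missingColor]
      have := treeDepth_le_of_adj (l + 2) y z h.2
      omega
    · obtain ⟨x', rfl⟩ := Fin.exists_succAbove_eq h'
      rw [treeColorDist_succAbove, treeColorDist_succAbove]
      exact treeColorDist_le_of_adj l x' y z h.2

theorem exists_adj_treeColorDist (hN : 1 ≤ N) : ∀ (l : ℕ) (x : Fin (N + l + 2)), 2 ≤ x.val →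
    ∀ v, treeColorDist N l x v ≠ 0 → ∃ u, (naryTree (N + 1) (l + 2)).Adj v u ∧
      treeColorDist N l x v = treeColorDist N l x u + 1
  | 0, x, hx, none, _ => by
    obtain ⟨a, rfl⟩ := Fin.exists_succ_eq.2 (show x ≠ 0 by rintro rfl; simp at hx)
    exact ⟨some (a, none), rfl, by simp [treeColorDist]⟩
  | 0, x, hx, some (a, none), h => by
    have ha : a.succ ≠ x := fun ha => h (if_pos ha)
    obtain ⟨b, rfl⟩ := Fin.exists_succAbove_eq ha.symm
    exact ⟨some (a, some (b, ())), ⟨rfl, rfl⟩, by simp [treeColorDist]⟩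
  | 0, x, hx, some (a, some (b, _)), h => by
    refine ⟨some (a, none), ⟨rfl, rfl⟩, ?_⟩
    have hb : a.succ.succAbove b ≠ x := fun hb => h (if_pos hb)
    simp only [treeColorDist, if_neg hb]
    split_ifs <;> rfl
  | l + 1, x, hx, none, _ => by
    obtain ⟨i, hi⟩ := exists_ne_missingColor hN l x
    refine ⟨some (i, naryTreeRoot (N + 1) (l + 2)), rfl, ?_⟩
    obtain ⟨x', rfl⟩ := Fin.exists_succAbove_eq hi
    rw [treeColorDist_succAbove, treeColorDist_root]
    rfl
  | l + 1, x, hx, some (i, y), h => by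
    by_cases h' : x = missingColor N l i
    · subst h'
      by_cases hy : y = naryTreeRoot (N + 1) (l + 2)
      · subst hy
        refine ⟨none, rfl, ?_⟩
        rw [treeColorDist_missingColor, treeDepth_root]
        rfl
      · obtain ⟨u, hu, hd⟩ := exists_adj_treeDepth _ y hy
        refine ⟨some (i, u), ⟨rfl, hu⟩, ?_⟩
        rw [treeColorDist_missingColor, treeColorDist_missingColor]
        omega
    · obtain ⟨x', rfl⟩ := Fin.exists_succAbove_eq h'
      rw [two_le_succAbove_iff] at hx
      rw [treeColorDist_succAbove] at h
      obtain ⟨u, hu, hd⟩ := exists_adj_treeColorDist hN l x' hx y h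
      refine ⟨some (i, u), ⟨rfl, hu⟩, ?_⟩
      rw [treeColorDist_succAbove, treeColorDist_succAbove]
      exact hd

/-- Climbing to the root and then using its distance `l + 1` gives this bound. It is two less than
the distance `l + 3 + treeDepth` to a missing color one level up, and this gap separates the
branches. -/
theorem treeColorDist_le : ∀ (l : ℕ) (x : Fin (N + l + 2)) (v),
    treeColorDist N l x v ≤ l + 1 + treeDepth (N + 1) (l + 2) v
  | 0, _, none => le_rfl
  | 0, x, some (a, none) => by
    simp only [treeColorDist, treeDepth]
    split_ifs <;> omega
  | 0, x, some (a, some (b, _)) => by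
    simp only [treeColorDist, treeDepth]
    split_ifs <;> omega
  | l + 1, x, none => Nat.le_add_right _ _
  | l + 1, x, some (i, y) => by
    have e : treeDepth (N + 1) (l + 1 + 2) (some (i, y)) = treeDepth (N + 1) (l + 2) y + 1 := rfl
    rw [e]
    by_cases h : x = missingColor N l i
    · subst h
      rw [treeColorDist_missingColor]
      omega
    · obtain ⟨x', rfl⟩ := Fin.exists_succAbove_eq h
      rw [treeColorDist_succAbove]
      have := treeColorDist_le l x' y
      omega

/-- Some color other than `0` and `1` differs from two given colors. -/
theorem exists_color_ne (hN : 3 ≤ N) (x y : Fin (N + 2)) :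
    ∃ z : Fin (N + 2), 2 ≤ z.val ∧ z ≠ x ∧ z ≠ y := by
  -- The colors `2`, `3`, `4` exist because `3 ≤ N`, and two given colors cannot exclude all three.
  by_contra! h
  have h2 := h ⟨2, by omega⟩ le_rfl
  have h3 := h ⟨3, by omega⟩ (by simp)
  have h4 := h ⟨4, by omega⟩ (by simp)
  simp only [Fin.ext_iff, ne_eq] at h2 h3 h4
  omega

/-- A leaf is at distance `2` from every color except its own and its neighbor's, while the root and
the star centers are within `1` of every color from `2` on. This separates leaves from the rest; the
other vertices have distinct colors. -/
theorem eq_of_treeColorDist_eq_zero_level (hN : 3 ≤ N) :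
    ∀ u v : NaryTreeVertex (N + 1) 2, treeColor N 0 u = treeColor N 0 v →
      (∀ x : Fin (N + 2), 2 ≤ x.val → treeColorDist N 0 x u = treeColorDist N 0 x v) → u = v := by
  have leaf_dist : ∀ (a b : Fin (N + 1)) (x : Fin (N + 2)), x ≠ a.succ.succAbove b → x ≠ a.succ →
      treeColorDist N 0 x (some (a, some (b, ()))) = 2 := by
    intro a b x h1 h2
    simp only [treeColorDist, if_neg h1.symm, if_neg h2.symm]
  have center_dist : ∀ (a : Fin (N + 1)) (x : Fin (N + 2)),
      treeColorDist N 0 x (some (a, none)) ≤ 1 := by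
    intro a x
    simp only [treeColorDist]
    split_ifs <;> omega
  rintro (_ | ⟨a, _ | ⟨b, ⟨⟩⟩⟩) (_ | ⟨a', _ | ⟨b', ⟨⟩⟩⟩) hc hd
  · rfl
  · exact absurd hc (Fin.succ_ne_zero a').symm
  · obtain ⟨z, hz, h1, h2⟩ := exists_color_ne hN (a'.succ.succAbove b') a'.succ
    have h3 := (hd z hz).trans (leaf_dist a' b' z h1 h2)
    exact absurd h3 (by simp [treeColorDist])
  · exact absurd hc (Fin.succ_ne_zero a)
  · obtain rfl : a = a' := Fin.succ_injective _ hc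
    rfl
  · obtain ⟨z, hz, h1, h2⟩ := exists_color_ne hN (a'.succ.succAbove b') a'.succ
    have h3 := (hd z hz).trans (leaf_dist a' b' z h1 h2)
    have := center_dist a z
    omega
  · obtain ⟨z, hz, h1, h2⟩ := exists_color_ne hN (a.succ.succAbove b) a.succ
    have h3 := (hd z hz).symm.trans (leaf_dist a b z h1 h2)
    exact absurd h3 (by simp [treeColorDist])
  · obtain ⟨z, hz, h1, h2⟩ := exists_color_ne hN (a.succ.succAbove b) a.succ
    have h3 := (hd z hz).symm.trans (leaf_dist a b z h1 h2)
    have := center_dist a' z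
    omega
  · have hc' : a.succ.succAbove b = a'.succ.succAbove b' := hc
    have haa : a = a' := by
      by_contra hne
      have hne' : a.succ ≠ a'.succ := fun h => hne (Fin.succ_injective _ h)
      -- For equally colored leaves at different centers, at least one center has a color other than
      -- `1`. That color is at distance `1` from its own leaf and `2` from the other.
      by_cases h2 : 2 ≤ a.succ.val
      · have h3 := (hd a.succ h2).trans (leaf_dist a' b' a.succ
          (hc' ▸ (Fin.succAbove_ne _ _).symm) hne')
        simp [treeColorDist] at h3
      · have h2' : 2 ≤ a'.succ.val := by
          rw [Fin.ext_iff] at hne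
          simp only [Fin.val_succ] at h2 ⊢
          omega
        have h3 := (hd a'.succ h2').symm.trans (leaf_dist a b a'.succ
          (hc' ▸ (Fin.succAbove_ne _ _).symm) hne'.symm)
        simp [treeColorDist] at h3
    subst haa
    obtain rfl : b = b' := Fin.succAbove_right_injective hc'
    rfl

theorem eq_of_treeColorDist_eq (hN : 3 ≤ N) : ∀ (l : ℕ) (u v : NaryTreeVertex (N + 1) (l + 2)),
    treeColor N l u = treeColor N l v →
      (∀ x, 2 ≤ x.val → treeColorDist N l x u = treeColorDist N l x v) → u = v
  | 0, u, v, hc, hd => eq_of_treeColorDist_eq_zero_level hN u v hc hd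
  | l + 1, none, none, _, _ => rfl
  | l + 1, none, some (i, y), _, hd => by
    have h := hd (missingColor N l i) (Nat.le_add_left _ _)
    rw [treeColorDist_missingColor] at h
    simp only [treeColorDist] at h
    omega
  | l + 1, some (i, y), none, _, hd => by
    have h := hd (missingColor N l i) (Nat.le_add_left _ _)
    rw [treeColorDist_missingColor] at h
    simp only [treeColorDist] at h
    omega
  | l + 1, some (i, y), some (j, z), hc, hd => by
    by_cases hij : i = j
    · subst hij
      have : y = z := by
        refine eq_of_treeColorDist_eq hN l y z (Fin.succAbove_right_injective hc) fun x hx => ?_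
        have h := hd _ ((two_le_succAbove_iff l i x).2 hx)
        rwa [treeColorDist_succAbove, treeColorDist_succAbove] at h
      rw [this]
    -- For different branches, `h1` with `treeColorDist_le` makes `z` deeper than `y` by at least
    -- `2`, and `h2` symmetrically makes `y` deeper than `z`.
    · have hne := fun h => hij (missingColor_injective N l h)
      have h1 := hd (missingColor N l i) (Nat.le_add_left _ _)
      have h2 := hd (missingColor N l j) (Nat.le_add_left _ _)
      rw [treeColorDist_missingColor] at h1 h2
      obtain ⟨x, hx⟩ := Fin.exists_succAbove_eq hne
      obtain ⟨x', hx'⟩ := Fin.exists_succAbove_eq (Ne.symm hne)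
      rw [← hx, treeColorDist_succAbove] at h1
      rw [← hx', treeColorDist_succAbove] at h2
      have h3 := treeColorDist_le l x z
      have h4 := treeColorDist_le l x' y
      omega

open SimpleGraph

theorem exists_isLocatingColoring (hN : 3 ≤ N) (l : ℕ) :
    ∃ c : (naryTree (N + 1) (l + 2)).Coloring (Fin (N + l + 2)), IsLocatingColoring c := by
  let c : (naryTree (N + 1) (l + 2)).Coloring (Fin (N + l + 2)) :=
    Coloring.mk (treeColor N l) fun h => treeColor_valid l _ _ h
  have hcode : ∀ x : Fin (N + l + 2), 2 ≤ x.val → ∀ v,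
      colorCode c v x = treeColorDist N l x v := fun x hx =>
    colorCode_eq_of_descent c x _ (treeColorDist_eq_zero_iff l x hx)
      (treeColorDist_le_of_adj l x) (exists_adj_treeColorDist (by omega) l x hx)
  refine ⟨c, treeColor_surjective (by omega) l, fun u v huv => ?_⟩
  refine eq_of_treeColorDist_eq hN l u v ?_ fun x hx => ?_
  · have h := (colorCode_eq_zero_iff c v (c v)).2 rfl
    rw [← huv] at h
    exact (colorCode_eq_zero_iff c u (c v)).1 h
  · have h := congrFun huv x
    rw [hcode x hx, hcode x hx] at h
    exact_mod_cast h

end UpperBound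

/-! ### Combining the bounds -/

theorem locatingChromaticNumber_naryTree_eq {n k : ℕ} (hk : 3 ≤ k) (hn : k ≤ n) (hn4 : 4 ≤ n)
    (hn' : (2 * (2 * k + 1)) ^ (k - 2) < n) :
    (naryTree n k).locatingChromaticNumber = ((n + k - 1 : ℕ) : ℕ∞) := by
  apply le_antisymm
  · obtain ⟨N, rfl⟩ : ∃ N, n = N + 1 := ⟨n - 1, by omega⟩
    obtain ⟨l, rfl⟩ : ∃ l, k = l + 2 := ⟨k - 2, by omega⟩
    have e : N + 1 + (l + 2) - 1 = N + l + 2 := by omega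
    rw [e]
    exact iInf₂_le (f := fun (m : ℕ) (_ : m ∈ {m : ℕ | 0 < m ∧ ∃ c :
      (naryTree (N + 1) (l + 2)).Coloring (Fin m), SimpleGraph.IsLocatingColoring c}) => (m : ℕ∞))
      (N + l + 2) ⟨by omega, exists_isLocatingColoring (by omega) l⟩
  · obtain ⟨j, rfl⟩ : ∃ j, k = j + 1 := ⟨k - 1, by omega⟩
    refine le_iInf₂ fun m hm => ?_
    obtain ⟨-, c, hc⟩ := hm
    have := le_of_isLocatingColoring (by omega) (by omega) hn' hc
    exact_mod_cast this

theorem theorem2 (k : ℕ) (hk : 4 ≤ k) :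
    {n : ℕ | 2 ≤ n ∧
      (naryTree n k).locatingChromaticNumber < ((n + k - 1 : ℕ) : ℕ∞)}.Finite ∧
    ∃ M : ℕ, ∀ n : ℕ, M ≤ n →
      (naryTree n k).locatingChromaticNumber = ((n + k - 1 : ℕ) : ℕ∞) := by
  -- The threshold exceeds `k` and the counting constant; since `4 ≤ k`, it also ensures `4 ≤ n`,
  -- which the construction needs.
  have key : ∀ n : ℕ, k + (2 * (2 * k + 1)) ^ (k - 2) + 1 ≤ n →
      (naryTree n k).locatingChromaticNumber = ((n + k - 1 : ℕ) : ℕ∞) := fun n hn =>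
    locatingChromaticNumber_naryTree_eq (by omega) (by omega) (by omega) (by omega)
  refine ⟨(Set.finite_lt_nat (k + (2 * (2 * k + 1)) ^ (k - 2) + 1)).subset ?_, _, key⟩
  rintro n ⟨-, hn⟩
  by_contra h
  exact hn.ne (key n (not_lt.1 h))
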